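/- Let $0<r<1<R$, let $\varphi$ be injective and holomorphic on the annulus $\{z\in\mathbb C: r<|z|<R\}$, and let $\gamma(t)=\varphi(e^{it})$, $t\in\mathbb R$, be the corresponding analytic Jordan curve, with trace $\gamma^*=\gamma(\mathbb R)$. (For instance, $\varphi$ may be a Riemann map of the unit disk onto the interior of an analytic Jordan curve, extended conformally to a neighbourhood of the closed disk.) For $k\in\{0,1,2,\dots\}\cup\{\infty\}$ let $C^k(\gamma^*)$ be the space of functions $f:\gamma^*\to\mathbb C$ such that $t\mapsto f(\gamma(t))$ is $k$ times continuously differentiable on $\mathbb R$ (infinitely differentiable if $k=\infty$), with the topology defined by the seminorms $$\sup_{t\in\mathbb R}\bigl|(f\circ\gamma)^{(l)}(t)\bigr|,\qquad l\in\{0,1,2,\dots\},\ l\le k.$$ A function $f:\gamma^*\to\mathbb C$ is *real analytic at* $\gamma(t_0)$ if there are a power series $\sum_{n\ge 0}a_n(t-t_0)^n$, $a_n\in\mathbb C$, with radius of convergence $\rho>0$ and a $\delta\in(0,\rho]$ such that $f(\gamma(t))=\sum_{n\ge 0}a_n(t-t_0)^n$ for $|t-t_0|<\delta$. It is *extendable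 at* $\gamma(t_0)$ if there are an open set $V\subseteq\mathbb C$ with $\gamma(t_0)\in V$ and a holomorphic $F:V\to\mathbb C$ with $F=f$ on $V\cap\gamma^*$. Then: 1. for every $f:\gamma^*\to\mathbb C$ and every $t_0\in\mathbb R$, $f$ is real analytic at $\gamma(t_0)$ if and only if $f$ is extendable at $\gamma(t_0)$; 2. for every $k=0,1,2,\dots,\infty$, the set of all $f\in C^k(\gamma^*)$ that are real analytic at no point of $\gamma^*$ is a dense $G_\delta$ subset of $C^k(\gamma^*)$. -/

import Mathlib

open Set Topology
open scoped ContDiff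

noncomputable section

namespace JordanCk

/-- `φ` is injective and holomorphic on an annulus `{r < |z| < R}`, `0 < r < 1 < R`, so that
`t ↦ φ (e^{it})` is an analytic Jordan curve.  Nothing is asked of `φ` off the annulus. -/
def IsAnalyticJordan (φ : ℂ → ℂ) : Prop :=
  ∃ r R : ℝ, 0 < r ∧ r < 1 ∧ 1 < R ∧
    DifferentiableOn ℂ φ {z : ℂ | r < ‖z‖ ∧ ‖z‖ < R} ∧
    InjOn φ {z : ℂ | r < ‖z‖ ∧ ‖z‖ < R}

/-- The `2π`-periodic parametrization `γ(t) = φ (e^{it})`. -/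
def curve (φ : ℂ → ℂ) (t : ℝ) : ℂ := φ (Complex.exp (t * Complex.I))

/-- The trace `γ*` of the curve. -/
def trace (φ : ℂ → ℂ) : Set ℂ := range (curve φ)

/-- The function `t ↦ f (γ t)` of the parameter. -/
def pull (φ : ℂ → ℂ) (f : trace φ → ℂ) (t : ℝ) : ℂ := f ⟨curve φ t, mem_range_self t⟩

/-- The functions on `γ*` that are `k` times continuously differentiable in the parameter
(`k = ⊤` means infinitely differentiable), as a vector space. -/
def ckSubmodule (φ : ℂ → ℂ) (k : ℕ∞) : Submodule ℂ (trace φ → ℂ) where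
  carrier := {f | ContDiff ℝ k (pull φ f)}
  zero_mem' := by
    change ContDiff ℝ k fun _ : ℝ => (0 : ℂ)
    exact contDiff_const
  add_mem' := by
    intro f g hf hg
    change ContDiff ℝ k fun t => pull φ f t + pull φ g t
    exact ContDiff.add hf hg
  smul_mem' := by
    intro c f hf
    change ContDiff ℝ k fun t => c • pull φ f t
    exact ContDiff.const_smul c hf

/-- The space `C^k(γ*)`.  It is a type of its own, so that it does not inherit the topology of
pointwise convergence. -/
def Ck (φ : ℂ → ℂ) (k : ℕ∞) : Type := ckSubmodule φ k

instance (φ : ℂ → ℂ) (k : ℕ∞) : AddCommGroup (Ck φ k) :=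
  inferInstanceAs (AddCommGroup (ckSubmodule φ k))

instance (φ : ℂ → ℂ) (k : ℕ∞) : Module ℂ (Ck φ k) :=
  inferInstanceAs (Module ℂ (ckSubmodule φ k))

/-- The function on `γ*` underlying an element of `C^k(γ*)`. -/
def Ck.fn {φ : ℂ → ℂ} {k : ℕ∞} (f : Ck φ k) : trace φ → ℂ := Subtype.val f

theorem Ck.contDiff {φ : ℂ → ℂ} {k : ℕ∞} (f : Ck φ k) : ContDiff ℝ k (pull φ f.fn) :=
  Subtype.property f

theorem curve_periodic (φ : ℂ → ℂ) : Function.Periodic (curve φ) (2 * Real.pi) := by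
  intro t
  have h : Complex.exp (((t + 2 * Real.pi : ℝ) : ℂ) * Complex.I)
      = Complex.exp (t * Complex.I) := by
    rw [Complex.exp_eq_exp_iff_exists_int]
    exact ⟨1, by push_cast; ring⟩
  simp only [curve, h]

theorem pull_periodic (φ : ℂ → ℂ) (f : trace φ → ℂ) :
    Function.Periodic (pull φ f) (2 * Real.pi) := by
  intro t
  exact congrArg f (Subtype.ext (curve_periodic φ t))

theorem bddAbove_deriv {φ : ℂ → ℂ} {k : ℕ∞} (f : Ck φ k) {l : ℕ} (hl : (l : ℕ∞) ≤ k) :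
    BddAbove (range fun t : ℝ => ‖iteratedDeriv l (pull φ f.fn) t‖) := by
  have hc : Continuous fun t : ℝ => ‖iteratedDeriv l (pull φ f.fn) t‖ :=
    (f.contDiff.continuous_iteratedDeriv l (by exact_mod_cast hl)).norm
  have hp : Function.Periodic (fun t : ℝ => ‖iteratedDeriv l (pull φ f.fn) t‖)
      (2 * Real.pi) := by
    intro t
    have h := iteratedDeriv_comp_add_const l (pull φ f.fn) (2 * Real.pi)
    rw [show (fun z => pull φ f.fn (z + 2 * Real.pi)) = pull φ f.fn from
      funext (pull_periodic φ f.fn)] at h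
    exact congrArg norm (congrFun h t).symm
  exact (hp.compact_of_continuous Real.two_pi_pos.ne' hc).bddAbove

/-- The seminorm `f ↦ sup_{t ∈ ℝ} |(f ∘ γ)^{(l)}(t)|` on `C^k(γ*)`, for `l ≤ k`. -/
def ckSeminorm (φ : ℂ → ℂ) (k : ℕ∞) (l : {l : ℕ // (l : ℕ∞) ≤ k}) : Seminorm ℂ (Ck φ k) :=
  Seminorm.of (fun f => ⨆ t : ℝ, ‖iteratedDeriv l (pull φ f.fn) t‖)
    (by
      intro f g
      refine ciSup_le fun t => ?_
      have hle : ((l : ℕ) : WithTop ℕ∞) ≤ (k : WithTop ℕ∞) := by exact_mod_cast l.2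
      have h : iteratedDeriv l (pull φ (f + g).fn) t
          = iteratedDeriv l (pull φ f.fn) t + iteratedDeriv l (pull φ g.fn) t :=
        iteratedDeriv_add (f.contDiff.of_le hle).contDiffAt (g.contDiff.of_le hle).contDiffAt
      rw [h]
      exact (norm_add_le _ _).trans
        (add_le_add (le_ciSup (bddAbove_deriv f l.2) t) (le_ciSup (bddAbove_deriv g l.2) t)))
    (by
      intro c f
      have hle : ((l : ℕ) : WithTop ℕ∞) ≤ (k : WithTop ℕ∞) := by exact_mod_cast l.2
      have h : ∀ t, iteratedDeriv l (pull φ (c • f).fn) t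
          = c • iteratedDeriv l (pull φ f.fn) t := fun t =>
        iteratedDeriv_const_smul (f.contDiff.of_le hle).contDiffAt c
      simp only [h, norm_smul]
      exact (Real.mul_iSup_of_nonneg (norm_nonneg c) _).symm)

instance (k : ℕ∞) : Nonempty {l : ℕ // (l : ℕ∞) ≤ k} := ⟨⟨0, by simp⟩⟩

/-- The topology of `C^k(γ*)`: the locally convex one given by the seminorms
`sup_t |(f ∘ γ)^{(l)}(t)|`, `l ≤ k` (all `l` if `k = ⊤`). -/
instance (φ : ℂ → ℂ) (k : ℕ∞) : TopologicalSpace (Ck φ k) :=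
  (SeminormFamily.moduleFilterBasis (𝕜 := ℂ) (ckSeminorm φ k)).topology

/-- `f` is real analytic at `γ(t₀)`: `f (γ t)` is the sum of a power series in `t - t₀` with
complex coefficients and positive radius of convergence, for `t` near `t₀`. -/
def RealAnalyticAt (φ : ℂ → ℂ) (f : trace φ → ℂ) (t₀ : ℝ) : Prop :=
  AnalyticAt ℝ (pull φ f) t₀

/-- `f` is extendable at `γ(t₀)`: it agrees on `V ∩ γ*` with a function that is holomorphic on
an open neighbourhood `V` of `γ(t₀)`. -/
def ExtendableAt (φ : ℂ → ℂ) (f : trace φ → ℂ) (t₀ : ℝ) : Prop :=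
  ∃ V : Set ℂ, IsOpen V ∧ curve φ t₀ ∈ V ∧
    ∃ F : ℂ → ℂ, DifferentiableOn ℂ F V ∧ ∀ w : trace φ, (w : ℂ) ∈ V → F w = f w

/-- The `f ∈ C^k(γ*)` that are real analytic at no point of the curve. -/
def nowhereRealAnalytic (φ : ℂ → ℂ) (k : ℕ∞) : Set (Ck φ k) :=
  {f | ∀ t₀ : ℝ, ¬ RealAnalyticAt φ f.fn t₀}

end JordanCk

end

open Filter

namespace JordanCk

/-! A power series in `t - t₀` also converges for complex arguments, giving a holomorphic `G` near
`t₀`. Since `Φ z = φ (exp (i z))` is injective and holomorphic near `t₀`, `G ∘ Φ⁻¹` extends `f`; the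
converse is composition with the analytic curve.

For the `G_δ` part, analyticity is an open condition, so it can be tested at rational multiples of
`2π`. The functions given there by a series with Cauchy bounds `M` form a closed set
(`isClosed_boundedAnalyticAt`), by compactness of the space of coefficients.

Density needs no Baire argument, only one nowhere analytic `g`: for each rational point at most one
`c` makes `f + c • g` analytic there, so arbitrarily small good `c` exist. Such a `g` is `∑ (n!)⁻ⁿ
exp (i n! t)`: at `2πq` its terms with `n ≥ q.den` are in phase, and the derivatives outgrow every
Cauchy estimate (`not_analyticAt_lacunaryTail`). -/

/-! ### Power series with Cauchy estimates -/

theorem exists_coeff_bound_of_analyticAt {h : ℝ → ℂ} {t₀ : ℝ} (hh : AnalyticAt ℝ h t₀) :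
    ∃ (M : ℕ) (a : ℕ → ℂ), 0 < M ∧ (∀ n, ‖a n‖ ≤ (M : ℝ) ^ (n + 1)) ∧
      (∀ t : ℝ, |t - t₀| ≤ 1 / (2 * M) → h t = ∑' n, a n * ((t : ℂ) - t₀) ^ n) ∧
      ∀ n, iteratedDeriv n h t₀ = n.factorial * a n := by
  obtain ⟨p, r, hp⟩ := hh
  obtain ⟨C, s, hC, hs, hb⟩ := p.le_mul_pow_of_radius_pos (hp.r_pos.trans_le hp.r_le)
  obtain ⟨r', hr'0, hr'⟩ := ENNReal.lt_iff_exists_nnreal_btwn.1 hp.r_pos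
  have hr'0 : (0 : ℝ) < r' := by exact_mod_cast hr'0
  -- A single integer controls both the coefficients and the radius: on `|t - t₀| ≤ 1 / (2 * M)` the
  -- series is dominated by a geometric one of ratio `1/2`.
  obtain ⟨M, hM⟩ := exists_nat_gt (max (max C s) (1 / r'))
  have hMC : C < M := (le_max_left _ _).trans_lt ((le_max_left _ _).trans_lt hM)
  have hMs : s < M := (le_max_right _ _).trans_lt ((le_max_left _ _).trans_lt hM)
  have hMr : 1 / (r' : ℝ) < M := (le_max_right _ _).trans_lt hM
  have hM0 : (0 : ℝ) < M := hC.trans hMC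
  refine ⟨M, p.coeff, by exact_mod_cast hM0, fun n => ?_, fun t ht => ?_, fun n => ?_⟩
  · rw [← FormalMultilinearSeries.norm_apply_eq_norm_coef, pow_succ']
    exact (hb n).trans (by gcongr)
  · have hlt : |t - t₀| < r' := by
      refine ht.trans_lt ?_
      rw [div_lt_iff₀ (by positivity)]
      rw [div_lt_iff₀ hr'0] at hMr
      nlinarith
    have hmem : t - t₀ ∈ Metric.eball (0 : ℝ) r := by
      rw [Metric.mem_eball, edist_zero_right]
      refine lt_of_lt_of_le ?_ hr'.le
      rw [← ofReal_norm, Real.norm_eq_abs, ENNReal.ofReal_lt_coe_iff (abs_nonneg _)]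
      exact hlt
    have := hp.hasSum hmem
    rw [add_sub_cancel] at this
    rw [← this.tsum_eq]
    refine tsum_congr fun n => ?_
    rw [FormalMultilinearSeries.apply_eq_pow_smul_coeff, Complex.real_smul]
    push_cast
    ring
  · have := hp.factorial_smul (1 : ℝ) n
    rw [iteratedDeriv_eq_iteratedFDeriv, ← this, nsmul_eq_mul]
    rfl

theorem norm_term_le {a : ℕ → ℂ} {M : ℕ} (hM : 0 < M) (ha : ∀ n, ‖a n‖ ≤ (M : ℝ) ^ (n + 1))
    {z : ℂ} (hz : ‖z‖ ≤ 1 / (2 * M)) (n : ℕ) : ‖a n * z ^ n‖ ≤ M * (1 / 2) ^ n := by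
  have hM' : (0 : ℝ) < M := by exact_mod_cast hM
  rw [norm_mul, norm_pow]
  calc ‖a n‖ * ‖z‖ ^ n ≤ (M : ℝ) ^ (n + 1) * (1 / (2 * M)) ^ n := by gcongr; exact ha n
    _ = M * (1 / 2) ^ n := by
      rw [pow_succ', mul_assoc, ← mul_pow]
      congr 2
      field_simp

theorem summable_bound (M : ℕ) : Summable fun n : ℕ => (M : ℝ) * (1 / 2) ^ n :=
  summable_geometric_two.mul_left _

theorem analyticAt_tsum_pow {a : ℕ → ℂ} {M : ℕ} (hM : 0 < M)
    (ha : ∀ n, ‖a n‖ ≤ (M : ℝ) ^ (n + 1)) (c : ℂ) :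
    AnalyticAt ℂ (fun z => ∑' n, a n * (z - c) ^ n) c := by
  have hd : DifferentiableOn ℂ (fun z => ∑' n, a n * (z - c) ^ n)
      (Metric.ball c (1 / (2 * M))) := by
    refine Complex.differentiableOn_tsum_of_summable_norm (summable_bound M) (fun n => ?_)
      Metric.isOpen_ball fun n w hw => norm_term_le hM ha ?_ n
    · fun_prop
    · rw [Metric.mem_ball, dist_eq_norm] at hw
      exact hw.le
  exact hd.analyticAt (Metric.ball_mem_nhds _ (by positivity))

theorem analyticAt_comp_ofReal {G : ℂ → ℂ} {t₀ : ℝ} (hG : AnalyticAt ℂ G t₀) :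
    AnalyticAt ℝ (fun t : ℝ => G t) t₀ :=
  hG.restrictScalars.comp (Complex.ofRealCLM.analyticAt t₀)

theorem eventually_abs_sub_le {M : ℕ} (hM : 0 < M) (t₀ : ℝ) :
    ∀ᶠ t in 𝓝 t₀, |t - t₀| ≤ 1 / (2 * M) := by
  filter_upwards [Metric.closedBall_mem_nhds t₀ (show (0 : ℝ) < 1 / (2 * M) by positivity)]
    with t ht
  rwa [Metric.mem_closedBall, Real.dist_eq] at ht

theorem analyticAt_of_eq_tsum {h : ℝ → ℂ} {t₀ : ℝ} {a : ℕ → ℂ} {M : ℕ} (hM : 0 < M)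
    (ha : ∀ n, ‖a n‖ ≤ (M : ℝ) ^ (n + 1))
    (hh : ∀ t : ℝ, |t - t₀| ≤ 1 / (2 * M) → h t = ∑' n, a n * ((t : ℂ) - t₀) ^ n) :
    AnalyticAt ℝ h t₀ := by
  refine (analyticAt_comp_ofReal (analyticAt_tsum_pow hM ha t₀)).congr ?_
  filter_upwards [eventually_abs_sub_le hM t₀] with t ht
  exact (hh t ht).symm

theorem exists_complex_extension {h : ℝ → ℂ} {t₀ : ℝ} (hh : AnalyticAt ℝ h t₀) :
    ∃ G : ℂ → ℂ, AnalyticAt ℂ G t₀ ∧ ∀ᶠ t : ℝ in 𝓝 t₀, G t = h t := by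
  obtain ⟨M, a, hM, ha, hs, -⟩ := exists_coeff_bound_of_analyticAt hh
  refine ⟨_, analyticAt_tsum_pow hM ha t₀, ?_⟩
  filter_upwards [eventually_abs_sub_le hM t₀] with t ht
  exact (hs t ht).symm

/-! ### Holomorphy of the inverse of an injective holomorphic map -/

section Inverse

variable {Φ Ψ : ℂ → ℂ} {U : Set ℂ}

theorem not_eventually_const_of_injOn (hU : IsOpen U) (hinj : InjOn Φ U) {z : ℂ} (hz : z ∈ U) :
    ¬ ∀ᶠ w in 𝓝 z, Φ w = Φ z := by
  intro h
  have h1 : ∀ᶠ w in 𝓝 z, w = z := by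
    filter_upwards [h, hU.mem_nhds hz] with w hw hwU
    exact hinj hwU hz hw
  obtain ⟨w, hw, hw'⟩ :=
    ((h1.filter_mono nhdsWithin_le_nhds).and (self_mem_nhdsWithin : {z}ᶜ ∈ 𝓝[≠] z)).exists
  exact hw' hw

theorem nhds_le_map_nhds_of_injOn (hU : IsOpen U) (hd : DifferentiableOn ℂ Φ U)
    (hinj : InjOn Φ U) {z : ℂ} (hz : z ∈ U) : 𝓝 (Φ z) ≤ map Φ (𝓝 z) :=
  (hd.analyticAt (hU.mem_nhds hz)).eventually_constant_or_nhds_le_map_nhds.resolve_left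
    (not_eventually_const_of_injOn hU hinj hz)

theorem eventually_deriv_ne_zero_of_injOn (hU : IsOpen U) (hd : DifferentiableOn ℂ Φ U)
    (hinj : InjOn Φ U) {z : ℂ} (hz : z ∈ U) : ∀ᶠ w in 𝓝[≠] z, deriv Φ w ≠ 0 := by
  have hA := (hd.analyticAt (hU.mem_nhds hz)).deriv
  refine hA.eventually_eq_zero_or_eventually_ne_zero.resolve_left fun h =>
    not_eventually_const_of_injOn hU hinj hz ?_
  obtain ⟨ε, hε, hball⟩ := Metric.eventually_nhds_iff_ball.1 (h.and (hU.mem_nhds hz))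
  filter_upwards [Metric.ball_mem_nhds z hε] with w hw
  exact Metric.isOpen_ball.is_const_of_deriv_eq_zero (convex_ball z ε).isPreconnected
    (hd.mono fun x hx => (hball x hx).2) (fun x hx => (hball x hx).1) hw
    (Metric.mem_ball_self hε)

theorem isOpen_image_of_injOn (hU : IsOpen U) (hd : DifferentiableOn ℂ Φ U)
    (hinj : InjOn Φ U) : IsOpen (Φ '' U) := by
  rw [isOpen_iff_mem_nhds]
  rintro _ ⟨z, hz, rfl⟩
  exact nhds_le_map_nhds_of_injOn hU hd hinj hz (image_mem_map (hU.mem_nhds hz))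

theorem continuousAt_leftInverse (hU : IsOpen U) (hd : DifferentiableOn ℂ Φ U)
    (hinj : InjOn Φ U) (hΨ : LeftInvOn Ψ Φ U) {z : ℂ} (hz : z ∈ U) :
    ContinuousAt Ψ (Φ z) := by
  have h : Tendsto (Ψ ∘ Φ) (𝓝 z) (𝓝 (Ψ (Φ z))) := by
    rw [hΨ hz]
    refine tendsto_id.congr' ?_
    filter_upwards [hU.mem_nhds hz] with w hw
    exact (hΨ hw).symm
  exact (tendsto_map'_iff.2 h).mono_left (nhds_le_map_nhds_of_injOn hU hd hinj hz)

/-- Nonvanishing of `Φ'` at `z` is not needed: zeros of `Φ'` are isolated, so `Ψ` is differentiable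
on a punctured neighbourhood of `Φ z`, and continuity (open mapping) makes the singularity
removable. -/
theorem analyticAt_leftInverse (hU : IsOpen U) (hd : DifferentiableOn ℂ Φ U)
    (hinj : InjOn Φ U) (hΨ : LeftInvOn Ψ Φ U) {z : ℂ} (hz : z ∈ U) :
    AnalyticAt ℂ Ψ (Φ z) := by
  have hc := continuousAt_leftInverse hU hd hinj hΨ hz
  refine Complex.analyticAt_of_differentiable_on_punctured_nhds_of_continuousAt ?_ hc
  have hc' : Tendsto Ψ (𝓝 (Φ z)) (𝓝 z) := by simpa only [ContinuousAt, hΨ hz] using hc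
  have h1 : ∀ᶠ w in 𝓝 (Φ z), Ψ w ≠ z → deriv Φ (Ψ w) ≠ 0 :=
    hc'.eventually (eventually_nhdsWithin_iff.1 (eventually_deriv_ne_zero_of_injOn hU hd hinj hz))
  rw [eventually_nhdsWithin_iff]
  filter_upwards [h1, (isOpen_image_of_injOn hU hd hinj).mem_nhds (mem_image_of_mem Φ hz)]
    with w hw hwU hne
  obtain ⟨x, hx, rfl⟩ := hwU
  rw [hΨ hx] at hw
  have hx' : deriv Φ x ≠ 0 := hw fun h => hne (by rw [h]; rfl)
  have hs := (hd.analyticAt (hU.mem_nhds hx)).hasStrictDerivAt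
  refine (hs.to_local_left_inverse hx' ?_).hasDerivAt.differentiableAt
  filter_upwards [hU.mem_nhds hx] with y hy
  exact hΨ hy

end Inverse

/-! ### Real analytic versus extendable -/

theorem exp_mul_I_eq_iff {z : ℂ} {t : ℝ} :
    Complex.exp (z * Complex.I) = Complex.exp (t * Complex.I) ↔
      ∃ n : ℤ, z = ((t + n * (2 * Real.pi) : ℝ) : ℂ) := by
  rw [Complex.exp_eq_exp_iff_exists_int]
  refine exists_congr fun n => ⟨fun h => ?_, fun h => ?_⟩
  · apply mul_right_cancel₀ Complex.I_ne_zero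
    rw [h]
    push_cast
    ring
  · rw [h]
    push_cast
    ring

theorem isOpen_annulus (r R : ℝ) : IsOpen {z : ℂ | r < ‖z‖ ∧ ‖z‖ < R} :=
  (isOpen_lt continuous_const continuous_norm).inter (isOpen_lt continuous_norm continuous_const)

theorem exp_mem_annulus {r R : ℝ} (hr : r < 1) (hR : 1 < R) (t : ℝ) :
    Complex.exp (t * Complex.I) ∈ {z : ℂ | r < ‖z‖ ∧ ‖z‖ < R} := by
  rw [mem_ofPred_eq, Complex.norm_exp_ofReal_mul_I]
  exact ⟨hr, hR⟩

variable {φ : ℂ → ℂ}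

theorem analyticAt_param (hφ : IsAnalyticJordan φ) (t : ℝ) :
    AnalyticAt ℂ (fun z : ℂ => φ (Complex.exp (z * Complex.I))) t := by
  obtain ⟨r, R, -, hr, hR, hd, -⟩ := hφ
  have h1 : AnalyticAt ℂ φ (Complex.exp (t * Complex.I)) :=
    hd.analyticAt ((isOpen_annulus r R).mem_nhds (exp_mem_annulus hr hR t))
  have h2 : AnalyticAt ℂ (fun z : ℂ => Complex.exp (z * Complex.I)) t := by fun_prop
  exact AnalyticAt.fun_comp (f := fun z : ℂ => Complex.exp (z * Complex.I)) h1 h2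

theorem analyticAt_curve (hφ : IsAnalyticJordan φ) (t : ℝ) : AnalyticAt ℝ (curve φ) t :=
  analyticAt_comp_ofReal (analyticAt_param hφ t)

theorem curve_eq_iff (hφ : IsAnalyticJordan φ) {s t : ℝ} (h : curve φ s = curve φ t) :
    ∃ n : ℤ, s = t + n * (2 * Real.pi) := by
  obtain ⟨r, R, -, hr, hR, -, hinj⟩ := hφ
  obtain ⟨n, hn⟩ := exp_mul_I_eq_iff.1
    (hinj (exp_mem_annulus hr hR s) (exp_mem_annulus hr hR t) h)
  exact ⟨n, by exact_mod_cast hn⟩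

theorem realAnalyticAt_of_extendableAt (hφ : IsAnalyticJordan φ) {f : trace φ → ℂ} {t₀ : ℝ}
    (h : ExtendableAt φ f t₀) : RealAnalyticAt φ f t₀ := by
  obtain ⟨V, hV, ht, F, hF, hFf⟩ := h
  have hA := analyticAt_curve hφ t₀
  have h1 : AnalyticAt ℝ F (curve φ t₀) := (hF.analyticAt (hV.mem_nhds ht)).restrictScalars
  refine (h1.fun_comp hA).congr ?_
  filter_upwards [hA.continuousAt.preimage_mem_nhds (hV.mem_nhds ht)] with t ht
  exact hFf ⟨curve φ t, mem_range_self t⟩ ht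

theorem extendableAt_of_realAnalyticAt (hφ : IsAnalyticJordan φ) {f : trace φ → ℂ} {t₀ : ℝ}
    (h : RealAnalyticAt φ f t₀) : ExtendableAt φ f t₀ := by
  obtain ⟨G, hG, hGf⟩ := exists_complex_extension h
  have hφ' := hφ
  obtain ⟨r, R, -, hr, hR, hd, hinj⟩ := hφ'
  set Φ : ℂ → ℂ := fun z => φ (Complex.exp (z * Complex.I)) with hΦ
  have hmem : ∀ᶠ z : ℂ in 𝓝 (t₀ : ℂ),
      Complex.exp (z * Complex.I) ∈ {z : ℂ | r < ‖z‖ ∧ ‖z‖ < R} :=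
    (show Continuous fun z : ℂ => Complex.exp (z * Complex.I) by fun_prop).continuousAt
      ((isOpen_annulus r R).mem_nhds (exp_mem_annulus hr hR t₀))
  obtain ⟨ε₁, hε₁, h₁⟩ := Metric.eventually_nhds_iff_ball.1
    ((hmem.and hG.eventually_analyticAt).and (analyticAt_param hφ t₀).eventually_analyticAt)
  obtain ⟨ε₂, hε₂, h₂⟩ := Metric.eventually_nhds_iff_ball.1 hGf
  -- The bound `1` keeps points of `U` less than `2 < 2π` apart, so `exp (i z)` is injective on `U`.
  set ε := min (min ε₁ ε₂) 1 with hε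
  have hε0 : 0 < ε := by positivity
  have hεa : ε ≤ ε₁ := (min_le_left _ _).trans (min_le_left _ _)
  have hεb : ε ≤ ε₂ := (min_le_left _ _).trans (min_le_right _ _)
  have hεc : ε ≤ 1 := min_le_right _ _
  set U := Metric.ball (t₀ : ℂ) ε with hUdef
  have hU : IsOpen U := Metric.isOpen_ball
  have h₁' : ∀ z ∈ U, _ := fun z hz => h₁ z (Metric.ball_subset_ball hεa hz)
  have hΦd : DifferentiableOn ℂ Φ U := fun z hz =>
    (h₁' z hz).2.differentiableAt.differentiableWithinAt
  have hΦi : InjOn Φ U := by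
    intro z hz w hw hzw
    obtain ⟨n, hn⟩ := Complex.exp_eq_exp_iff_exists_int.1 (hinj (h₁' z hz).1.1 (h₁' w hw).1.1 hzw)
    have hn' : z - w = n * (2 * Real.pi) := by
      apply mul_right_cancel₀ Complex.I_ne_zero
      rw [sub_mul, hn]
      ring
    have hlt : ‖z - w‖ < 2 := by
      rw [← dist_eq_norm]
      have := dist_triangle_right z w t₀
      rw [hUdef, Metric.mem_ball] at hz hw
      linarith
    have hn0 : n = 0 := by
      by_contra hn0
      have h1 : (1 : ℝ) ≤ |(n : ℝ)| := by exact_mod_cast Int.one_le_abs hn0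
      rw [hn'] at hlt
      have : ‖(n : ℂ) * (2 * Real.pi)‖ = |(n : ℝ)| * (2 * Real.pi) := by
        rw [norm_mul, Complex.norm_intCast, norm_mul, Complex.norm_real,
          Real.norm_of_nonneg Real.pi_pos.le]
        norm_num
      rw [this] at hlt
      nlinarith [Real.pi_gt_three]
    rw [hn0] at hn'
    exact sub_eq_zero.1 (by simpa using hn')
  have hΨ : LeftInvOn (Function.invFunOn Φ U) Φ U := hΦi.leftInvOn_invFunOn
  refine ⟨Φ '' U, isOpen_image_of_injOn hU hΦd hΦi, ⟨t₀, Metric.mem_ball_self hε0, rfl⟩,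
    fun w => G (Function.invFunOn Φ U w), ?_, ?_⟩
  · rintro _ ⟨z, hz, rfl⟩
    refine DifferentiableAt.differentiableWithinAt ?_
    have hGz : AnalyticAt ℂ G (Function.invFunOn Φ U (Φ z)) := by
      rw [hΨ hz]
      exact (h₁' z hz).1.2
    exact (hGz.fun_comp (analyticAt_leftInverse hU hΦd hΦi hΨ hz)).differentiableAt
  · rintro ⟨_, t, rfl⟩ ⟨z, hz, hzt⟩
    -- The parameter `t` may be far from `t₀`, but injectivity on the whole annulus forces `z = t +
    -- 2πn`: `z` is real and close to `t₀`, where `G` agrees with the periodic `pull φ f`.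
    obtain ⟨n, hn⟩ := exp_mul_I_eq_iff.1 (hinj (h₁' z hz).1.1 (exp_mem_annulus hr hR t) hzt)
    change G (Function.invFunOn Φ U (curve φ t)) = pull φ f t
    rw [← (show Φ z = curve φ t from hzt), hΨ hz, hn, h₂, (pull_periodic φ f).int_mul n t]
    rw [hn, hUdef, Metric.mem_ball, Complex.dist_eq, ← Complex.ofReal_sub, Complex.norm_real] at hz
    rw [Metric.mem_ball, dist_eq_norm]
    exact hz.trans_le hεb

/-! ### A smooth periodic function that is nowhere analytic -/

/-- The `n`-th term of a lacunary Fourier series with super-exponentially growing frequencies. -/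
noncomputable def lacunaryTerm (n : ℕ) (t : ℝ) : ℂ :=
  ((n.factorial : ℂ) ^ n)⁻¹ * Complex.exp (n.factorial * Complex.I * t)

/-- The tail from index `j` on of the lacunary Fourier series. -/
noncomputable def lacunaryTail (j : ℕ) (t : ℝ) : ℂ := ∑' n, lacunaryTerm (n + j) t

theorem iteratedDeriv_lacunaryTerm (n l : ℕ) :
    iteratedDeriv l (lacunaryTerm n)
      = fun t => (n.factorial * Complex.I) ^ l * lacunaryTerm n t := by
  induction l with
  | zero => simp [iteratedDeriv_zero]
  | succ l ih =>
    rw [iteratedDeriv_succ, ih]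
    funext t
    have h0 : HasDerivAt (fun s : ℝ => (s : ℂ)) 1 t := Complex.ofRealCLM.hasDerivAt
    have h1 : HasDerivAt (fun s : ℝ => (n.factorial * Complex.I) ^ l * lacunaryTerm n s)
        _ t :=
      (((h0.const_mul (n.factorial * Complex.I)).cexp).const_mul
        (((n.factorial : ℂ) ^ n)⁻¹)).const_mul ((n.factorial * Complex.I) ^ l)
    rw [h1.deriv, lacunaryTerm]
    ring

theorem contDiff_lacunaryTerm (n : ℕ) {k : WithTop ℕ∞} : ContDiff ℝ k (lacunaryTerm n) :=
  contDiff_const.mul ((contDiff_const.mul Complex.ofRealCLM.contDiff).cexp)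

theorem norm_lacunaryTerm (n : ℕ) (t : ℝ) :
    ‖lacunaryTerm n t‖ = ((n.factorial : ℝ) ^ n)⁻¹ := by
  have : (n.factorial * Complex.I * t : ℂ) = ((n.factorial * t : ℝ) : ℂ) * Complex.I := by
    push_cast
    ring
  rw [lacunaryTerm, this, norm_mul, Complex.norm_exp_ofReal_mul_I, mul_one, norm_inv, norm_pow,
    Complex.norm_natCast]

theorem norm_iteratedDeriv_lacunaryTerm (n l : ℕ) (t : ℝ) :
    ‖iteratedDeriv l (lacunaryTerm n) t‖
      = (n.factorial : ℝ) ^ l * ((n.factorial : ℝ) ^ n)⁻¹ := by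
  rw [iteratedDeriv_lacunaryTerm, norm_mul, norm_pow, norm_mul, Complex.norm_I, mul_one,
    Complex.norm_natCast, norm_lacunaryTerm]

theorem summable_factorial_pow (l : ℕ) :
    Summable fun n : ℕ => (n.factorial : ℝ) ^ l * ((n.factorial : ℝ) ^ n)⁻¹ := by
  have h := Real.summable_pow_div_factorial 1
  refine Summable.of_norm_bounded_eventually_nat h ?_
  -- For `n > l` the term is at most `1 / n!`.
  filter_upwards [eventually_gt_atTop l] with n hn
  have h1 : (1 : ℝ) ≤ n.factorial := by exact_mod_cast n.factorial_pos
  have h0 : (0 : ℝ) < n.factorial := by positivity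
  rw [Real.norm_of_nonneg (by positivity), one_pow, ← div_eq_mul_inv,
    div_le_div_iff₀ (by positivity) h0, one_mul, ← pow_succ]
  exact pow_le_pow_right₀ h1 hn

theorem summable_factorial_pow_add (j l : ℕ) : Summable fun n : ℕ =>
    ((n + j).factorial : ℝ) ^ l * (((n + j).factorial : ℝ) ^ (n + j))⁻¹ :=
  (summable_nat_add_iff j).2 (summable_factorial_pow l)

theorem contDiff_lacunaryTail (j : ℕ) : ContDiff ℝ ∞ (lacunaryTail j) := by
  refine contDiff_tsum (fun n => contDiff_lacunaryTerm (n + j))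
    (fun l _ => summable_factorial_pow_add j l) fun l n t _ => ?_
  rw [norm_iteratedFDeriv_eq_norm_iteratedDeriv, norm_iteratedDeriv_lacunaryTerm]

theorem summable_lacunaryTerm (t : ℝ) : Summable fun n => lacunaryTerm n t :=
  Summable.of_norm_bounded (summable_factorial_pow 0) fun n => by
    rw [norm_lacunaryTerm, pow_zero, one_mul]

theorem iteratedDeriv_lacunaryTail (j l : ℕ) (t : ℝ) :
    iteratedDeriv l (lacunaryTail j) t
      = ∑' n, ((n + j).factorial * Complex.I) ^ l * lacunaryTerm (n + j) t := by
  have h := iteratedFDeriv_tsum_apply (𝕜 := ℝ) (N := ⊤) (f := fun n => lacunaryTerm (n + j))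
    (fun n => contDiff_lacunaryTerm (n + j))
    (fun l _ => summable_factorial_pow_add j l) (fun l n t _ => by
      rw [norm_iteratedFDeriv_eq_norm_iteratedDeriv, norm_iteratedDeriv_lacunaryTerm])
    (k := l) le_top t
  have hs : Summable fun n => iteratedFDeriv ℝ l (lacunaryTerm (n + j)) t :=
    Summable.of_norm_bounded (summable_factorial_pow_add j l) fun n => by
      rw [norm_iteratedFDeriv_eq_norm_iteratedDeriv, norm_iteratedDeriv_lacunaryTerm]
  rw [iteratedDeriv_eq_iteratedFDeriv]
  change iteratedFDeriv ℝ l (fun y => ∑' n, lacunaryTerm (n + j) y) t _ = _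
  rw [h, ContinuousMultilinearMap.tsum_eval hs]
  refine tsum_congr fun n => ?_
  rw [← iteratedDeriv_eq_iteratedFDeriv, iteratedDeriv_lacunaryTerm]

theorem lacunaryTerm_two_pi_mul_rat (q : ℚ) {n : ℕ} (hn : q.den ≤ n) :
    lacunaryTerm n (2 * Real.pi * q) = ((n.factorial : ℂ) ^ n)⁻¹ := by
  obtain ⟨d, hd⟩ := Nat.dvd_factorial q.den_pos hn
  have h : Complex.exp (n.factorial * Complex.I * ((2 * Real.pi * q : ℝ) : ℂ)) = 1 := by
    rw [Complex.exp_eq_one_iff]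
    refine ⟨d * q.num, ?_⟩
    have hq : (q : ℂ) * q.den = q.num := by exact_mod_cast q.mul_den_eq_num
    rw [hd]
    push_cast
    rw [← hq]
    ring
  rw [lacunaryTerm, h, mul_one]

/-- All exponentials equal `1` at `2πq`, so the derivative is `I ^ (2 * m)` times a sum of positive
terms; the one of frequency `m!` alone contributes `(m!) ^ (2m - m)`. -/
theorem le_norm_iteratedDeriv_lacunaryTail (q : ℚ) {m : ℕ} (hm : q.den ≤ m) :
    (m.factorial : ℝ) ^ m
      ≤ ‖iteratedDeriv (2 * m) (lacunaryTail q.den) (2 * Real.pi * q)‖ := by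
  have hs := summable_factorial_pow_add q.den (2 * m)
  have h1 : iteratedDeriv (2 * m) (lacunaryTail q.den) (2 * Real.pi * q)
      = Complex.I ^ (2 * m) * ((∑' n, ((n + q.den).factorial : ℝ) ^ (2 * m) *
        (((n + q.den).factorial : ℝ) ^ (n + q.den))⁻¹ : ℝ) : ℂ) := by
    rw [iteratedDeriv_lacunaryTail, Complex.ofReal_tsum, ← tsum_mul_left]
    refine tsum_congr fun n => ?_
    rw [lacunaryTerm_two_pi_mul_rat q (Nat.le_add_left _ _)]
    push_cast
    ring
  have h2 := hs.le_tsum (m - q.den) fun n _ => by positivity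
  rw [Nat.sub_add_cancel hm] at h2
  rw [h1, norm_mul, norm_pow, Complex.norm_I, one_pow, one_mul, Complex.norm_real]
  refine le_trans (le_of_eq ?_) (h2.trans (le_abs_self _))
  rw [eq_mul_inv_iff_mul_eq₀ (by positivity), ← pow_add, two_mul]

/-- Analyticity would give `(m!)^m ≤ (2m)! M^(2m+1) ≤ (4 M³ m²)^m`, hence `m! ≤ 4 M³ m²` for all
large `m`. -/
theorem not_analyticAt_lacunaryTail (q : ℚ) :
    ¬ AnalyticAt ℝ (lacunaryTail q.den) (2 * Real.pi * q) := by
  intro h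
  obtain ⟨M, a, hM, ha, -, hd⟩ := exists_coeff_bound_of_analyticAt h
  have key : ∀ m : ℕ, q.den ≤ m → 0 < m → m.factorial ≤ 4 * M ^ 3 * m ^ 2 := by
    intro m hm hm0
    have h1 := le_norm_iteratedDeriv_lacunaryTail q hm
    rw [hd, norm_mul, Complex.norm_natCast] at h1
    have h2 : (m.factorial : ℝ) ^ m ≤ (2 * m).factorial * (M : ℝ) ^ (2 * m + 1) :=
      h1.trans (by gcongr; exact ha _)
    have h3 : m.factorial ^ m ≤ (2 * m).factorial * M ^ (2 * m + 1) := by exact_mod_cast h2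
    have h4 : m.factorial ^ m ≤ (4 * M ^ 3 * m ^ 2) ^ m :=
      calc m.factorial ^ m ≤ (2 * m).factorial * M ^ (2 * m + 1) := h3
        _ ≤ (2 * m) ^ (2 * m) * M ^ (3 * m) :=
          Nat.mul_le_mul (Nat.factorial_le_pow _) (Nat.pow_le_pow_right hM (by omega))
        _ = (4 * M ^ 3 * m ^ 2) ^ m := by
          rw [pow_mul, pow_mul, ← mul_pow]
          congr 1
          ring
    exact (Nat.pow_le_pow_iff_left hm0.ne').1 h4
  -- Taking `m = p + 2` in `key` and cancelling `(p + 2) * (p + 1)` leaves `p ≤ 8 * M ^ 3`.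
  obtain ⟨p, hp1, hp2⟩ : ∃ p : ℕ, q.den ≤ p ∧ 16 * M ^ 3 < p :=
    ⟨q.den + 16 * M ^ 3 + 1, by omega, by omega⟩
  have h5 := key (p + 2) (by omega) (by omega)
  rw [Nat.factorial_succ, Nat.factorial_succ] at h5
  have h6 := p.self_le_factorial
  have h7 : (p + 2) ^ 2 ≤ 2 * ((p + 2) * (p + 1)) := by nlinarith
  have h8 : (p + 2) * (p + 1) * p ≤ (p + 2) * (p + 1) * (8 * M ^ 3) :=
    calc (p + 2) * (p + 1) * p ≤ (p + 2) * (p + 1) * p.factorial := Nat.mul_le_mul_left _ h6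
      _ = (p + 1 + 1) * ((p + 1) * p.factorial) := by ring
      _ ≤ 4 * M ^ 3 * (p + 2) ^ 2 := h5
      _ ≤ 4 * M ^ 3 * (2 * ((p + 2) * (p + 1))) := Nat.mul_le_mul_left _ h7
      _ = _ := by ring
  have h9 := Nat.le_of_mul_le_mul_left h8 (by positivity)
  omega

theorem analyticAt_lacunaryTerm (n : ℕ) (t : ℝ) : AnalyticAt ℝ (lacunaryTerm n) t :=
  analyticAt_comp_ofReal
    (G := fun z => ((n.factorial : ℂ) ^ n)⁻¹ * Complex.exp (n.factorial * Complex.I * z))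
    (by fun_prop)

theorem not_analyticAt_lacunaryTail_zero_rat (q : ℚ) :
    ¬ AnalyticAt ℝ (lacunaryTail 0) (2 * Real.pi * q) := by
  intro h
  refine not_analyticAt_lacunaryTail q ?_
  have h1 : lacunaryTail q.den
      = fun t => lacunaryTail 0 t - ∑ n ∈ Finset.range q.den, lacunaryTerm n t := by
    funext t
    rw [eq_sub_iff_add_eq']
    exact (summable_lacunaryTerm t).sum_add_tsum_nat_add q.den
  rw [h1]
  exact h.fun_sub (Finset.analyticAt_fun_sum _ fun n _ => analyticAt_lacunaryTerm n _)

theorem exists_rat_of_eventually {P : ℝ → Prop} {t : ℝ} (h : ∀ᶠ s in 𝓝 t, P s) :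
    ∃ q : ℚ, P (2 * Real.pi * q) := by
  have hc : ContinuousAt (fun s : ℝ => 2 * Real.pi * s) (t / (2 * Real.pi)) := by fun_prop
  have ht : 2 * Real.pi * (t / (2 * Real.pi)) = t := by field_simp
  rw [ContinuousAt, ht] at hc
  obtain ⟨q, hs⟩ := (Rat.denseRange_cast (𝕜 := ℝ)).mem_nhds (hc.eventually h)
  exact ⟨q, hs⟩

theorem not_analyticAt_lacunaryTail_zero (t : ℝ) : ¬ AnalyticAt ℝ (lacunaryTail 0) t := by
  intro h
  obtain ⟨q, hq⟩ := exists_rat_of_eventually h.eventually_analyticAt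
  exact not_analyticAt_lacunaryTail_zero_rat q hq

theorem lacunaryTail_periodic (j : ℕ) : Function.Periodic (lacunaryTail j) (2 * Real.pi) := by
  intro t
  refine tsum_congr fun n => ?_
  have h : Complex.exp ((n + j).factorial * Complex.I * ((t + 2 * Real.pi : ℝ) : ℂ))
      = Complex.exp ((n + j).factorial * Complex.I * t) := by
    rw [Complex.exp_eq_exp_iff_exists_int]
    exact ⟨(n + j).factorial, by push_cast; ring⟩
  simp only [lacunaryTerm, h]

/-! ### Density and the `G_δ` property in `C^k(γ*)` -/

variable {φ : ℂ → ℂ} {k : ℕ∞}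

theorem exists_pull_eq (hφ : IsAnalyticJordan φ) {h : ℝ → ℂ}
    (hp : Function.Periodic h (2 * Real.pi)) : ∃ f : trace φ → ℂ, pull φ f = h := by
  refine ⟨fun w => h (Classical.choose w.2), funext fun t => ?_⟩
  obtain ⟨n, hn⟩ := curve_eq_iff hφ (Classical.choose_spec (mem_range_self (f := curve φ) t))
  change h (Classical.choose (mem_range_self (f := curve φ) t)) = h t
  rw [hn, hp.int_mul n t]

theorem exists_mem_nowhereRealAnalytic (hφ : IsAnalyticJordan φ) (k : ℕ∞) :
    ∃ g : Ck φ k, g ∈ nowhereRealAnalytic φ k := by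
  obtain ⟨f, hf⟩ := exists_pull_eq hφ (lacunaryTail_periodic 0)
  have hc : ContDiff ℝ k (pull φ f) := by
    rw [hf]
    exact (contDiff_lacunaryTail 0).of_le (by exact_mod_cast le_top)
  refine ⟨⟨f, hc⟩, fun t h => not_analyticAt_lacunaryTail_zero t ?_⟩
  rw [← hf]
  exact h

theorem withSeminorms_ckSeminorm (φ : ℂ → ℂ) (k : ℕ∞) : WithSeminorms (ckSeminorm φ k) := ⟨rfl⟩

instance : IsTopologicalAddGroup (Ck φ k) := (withSeminorms_ckSeminorm φ k).topologicalAddGroup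

instance : ContinuousSMul ℂ (Ck φ k) := (withSeminorms_ckSeminorm φ k).continuousSMul

theorem continuous_pull (t : ℝ) : Continuous fun f : Ck φ k => pull φ f.fn t := by
  set l : {l : ℕ // (l : ℕ∞) ≤ k} := ⟨0, by simp⟩
  have hs : Continuous (ckSeminorm φ k l) := (withSeminorms_ckSeminorm φ k).continuous_seminorm l
  rw [continuous_iff_continuousAt]
  intro f
  rw [ContinuousAt, tendsto_iff_norm_sub_tendsto_zero]
  have h0 : Tendsto (fun g : Ck φ k => ckSeminorm φ k l (g - f)) (𝓝 f) (𝓝 0) := by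
    have : Continuous fun g : Ck φ k => ckSeminorm φ k l (g - f) :=
      hs.comp (continuous_id.sub continuous_const)
    simpa using this.tendsto f
  refine squeeze_zero (fun _ => norm_nonneg _) (fun g => ?_) h0
  have h := le_ciSup (bddAbove_deriv (g - f) l.2) t
  simp only [l, iteratedDeriv_zero] at h
  exact h

/-- The functions that are given near the parameter `t₀` by a power series whose coefficients
satisfy the Cauchy estimates with constant `M`. -/
def boundedAnalyticAt (φ : ℂ → ℂ) (k : ℕ∞) (t₀ : ℝ) (M : ℕ) : Set (Ck φ k) :=
  {f | ∃ a : ℕ → ℂ, (∀ n, ‖a n‖ ≤ (M : ℝ) ^ (n + 1)) ∧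
    ∀ t : ℝ, |t - t₀| ≤ 1 / (2 * M) → pull φ f.fn t = ∑' n, a n * ((t : ℂ) - t₀) ^ n}

/-- The admissible coefficient sequences form a compact product of discs `K`. The uniform geometric
bound makes the sum continuous in them, so the relation between `f` and `a` is closed, and
projecting along the compact factor `K` preserves closedness. -/
theorem isClosed_boundedAnalyticAt (t₀ : ℝ) {M : ℕ} (hM : 0 < M) :
    IsClosed (boundedAnalyticAt φ k t₀ M) := by
  set K : Set (ℕ → ℂ) := Set.pi univ fun n => Metric.closedBall 0 ((M : ℝ) ^ (n + 1)) with hK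
  have hmem : ∀ a : ℕ → ℂ, a ∈ K ↔ ∀ n, ‖a n‖ ≤ (M : ℝ) ^ (n + 1) := fun a => by simp [hK]
  have : CompactSpace K := isCompact_iff_compactSpace.1
    (isCompact_univ_pi fun n => isCompact_closedBall _ _)
  have hcl : IsClosed {x : Ck φ k × K | ∀ t : ℝ, |t - t₀| ≤ 1 / (2 * M) →
      pull φ x.1.fn t = ∑' n, (x.2 : ℕ → ℂ) n * ((t : ℂ) - t₀) ^ n} := by
    simp only [ofPred_forall]
    refine isClosed_iInter fun t => isClosed_iInter fun ht => ?_
    refine isClosed_eq ((continuous_pull t).comp continuous_fst) ?_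
    refine continuous_tsum (fun n => ?_) (summable_bound M) fun n x =>
      norm_term_le hM ((hmem _).1 x.2.2) ?_ n
    · exact ((continuous_apply n).comp (continuous_subtype_val.comp continuous_snd)).mul
        continuous_const
    · rwa [← Complex.ofReal_sub, Complex.norm_real]
  convert isClosedMap_fst_of_compactSpace _ hcl
  ext f
  constructor
  · rintro ⟨a, ha, h⟩
    exact ⟨(f, ⟨a, (hmem a).2 ha⟩), h, rfl⟩
  · rintro ⟨⟨_, a, ha⟩, h, rfl⟩
    exact ⟨a, (hmem a).1 ha, h⟩

/-- The index `M + 1` excludes `M = 0`, for which `1 / (2 * M) = 0` and the condition would only say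
that `f` vanishes at the point. -/
theorem nowhereRealAnalytic_eq : nowhereRealAnalytic φ k =
    ⋂ (q : ℚ) (M : ℕ), (boundedAnalyticAt φ k (2 * Real.pi * q) (M + 1))ᶜ := by
  ext f
  simp only [mem_iInter, mem_compl_iff]
  constructor
  · rintro hf q M ⟨a, ha, h⟩
    exact hf _ (analyticAt_of_eq_tsum M.succ_pos ha h)
  · intro hf t ht
    obtain ⟨q, hq⟩ := exists_rat_of_eventually (AnalyticAt.eventually_analyticAt ht)
    obtain ⟨M, a, hM, ha, h, -⟩ := exists_coeff_bound_of_analyticAt hq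
    obtain ⟨M, rfl⟩ := Nat.exists_eq_succ_of_ne_zero hM.ne'
    exact hf q M ⟨a, ha, h⟩

theorem isGδ_nowhereRealAnalytic : IsGδ (nowhereRealAnalytic φ k) := by
  rw [nowhereRealAnalytic_eq]
  exact .iInter fun q => .iInter fun M =>
    (isClosed_boundedAnalyticAt _ M.succ_pos).isOpen_compl.isGδ

/-- If `c ≠ d` were bad at the same rational point, the difference `(c - d) • g` would be analytic
there; so bad scalars inject into `ℚ`. -/
theorem countable_setOf_add_smul_notMem {f g : Ck φ k} (hg : g ∈ nowhereRealAnalytic φ k) :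
    {c : ℂ | f + c • g ∉ nowhereRealAnalytic φ k}.Countable := by
  have h : ∀ c : ℂ, f + c • g ∉ nowhereRealAnalytic φ k →
      ∃ q : ℚ, AnalyticAt ℝ (pull φ (f + c • g).fn) (2 * Real.pi * q) := by
    intro c hc
    obtain ⟨t, ht⟩ := not_forall_not.1 hc
    exact exists_rat_of_eventually (AnalyticAt.eventually_analyticAt ht)
  choose! q hq using h
  refine countable_of_injective_of_countable_image (f := q) ?_ (to_countable _)
  intro c hc d hd hcd
  by_contra hne
  refine hg (2 * Real.pi * q c) ?_
  have h1 := hq c hc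
  have h2 := hq d hd
  rw [← hcd] at h2
  refine ((h1.sub h2).const_smul (c := (c - d)⁻¹)).congr (Eventually.of_forall fun t => ?_)
  change (c - d)⁻¹ * ((pull φ f.fn t + c * pull φ g.fn t)
    - (pull φ f.fn t + d * pull φ g.fn t)) = pull φ g.fn t
  have := sub_ne_zero.2 hne
  field_simp
  ring

theorem dense_nowhereRealAnalytic (hφ : IsAnalyticJordan φ) :
    Dense (nowhereRealAnalytic φ k) := by
  obtain ⟨g, hg⟩ := exists_mem_nowhereRealAnalytic hφ k
  intro f
  have hd := (countable_setOf_add_smul_notMem (f := f) hg).dense_compl ℝ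
  have hc : Continuous fun c : ℂ => f + c • g := by fun_prop
  have h := hc.continuousWithinAt.mem_closure (hd 0) (t := nowhereRealAnalytic φ k)
    fun c hc => not_not.1 hc
  simpa using h

end JordanCk

theorem theorem5p11 (φ : ℂ → ℂ) (hφ : JordanCk.IsAnalyticJordan φ) :
    (∀ (f : JordanCk.trace φ → ℂ) (t₀ : ℝ),
      JordanCk.RealAnalyticAt φ f t₀ ↔ JordanCk.ExtendableAt φ f t₀) ∧
    ∀ k : ℕ∞,
      Dense (JordanCk.nowhereRealAnalytic φ k) ∧ IsGδ (JordanCk.nowhereRealAnalytic φ k) :=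
  ⟨fun _ _ => ⟨JordanCk.extendableAt_of_realAnalyticAt hφ,
    JordanCk.realAnalyticAt_of_extendableAt hφ⟩,
    fun _ => ⟨JordanCk.dense_nowhereRealAnalytic hφ, JordanCk.isGδ_nowhereRealAnalytic⟩⟩
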